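/- Let $I=[0,1]$ and let $f:I\to I$ be continuous. Let $\mathcal K(I)$ be the space of non-empty compact subsets of $I$ with the Hausdorff metric, and let $\overline f:\mathcal K(I)\to\mathcal K(I)$, $\overline f(K)=f(K)$, be the map induced by $f$. For a continuous self-map $g$ of a compact metric space $(X,d)$ and $\varepsilon>0$, call $g$ *generically chaotic* if the set of pairs $(x,y)\in X^2$ with $$\liminf_{n\to\infty} d(g^n(x),g^n(y))=0\quad\text{and}\quad \limsup_{n\to\infty} d(g^n(x),g^n(y))>0$$ is residual in $X^2$ (its complement is of first category), and *generically $\varepsilon$-chaotic* if the set of pairs $(x,y)\in X^2$ with $$\liminf_{n\to\infty} d(g^n(x),g^n(y))=0\quad\text{and}\quad \limsup_{n\to\infty} d(g^n(x),g^n(y))>\varepsilon$$ is residual in $X^2$. Then: 1. for every $\varepsilon>0$, if $f$ is generically $\varepsilon$-chaotic, then $\overline f$ is generically $\varepsilon$-chaotic (with the same $\varepsilon$); 2. if $f$ is generically chaotic, then $\overline f$ is generically chaotic; 3. if $\overline f$ is generically chaotic, then there is an $\varepsilon>0$ such that $\overline f$ is generically $\varepsilon$-chaotic. -/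

import Mathlib

open Filter TopologicalSpace

noncomputable section

/-- The pairs `(x, y)` with `liminf d(fⁿ x, fⁿ y) = 0`. Distances in a compact space are bounded,
so the real-valued `liminf` and `limsup` here and below are the genuine ones. -/
def proximalPairs {X : Type*} [MetricSpace X] [CompactSpace X] (f : C(X, X)) : Set (X × X) :=
  {p | liminf (fun n : ℕ => dist (f^[n] p.1) (f^[n] p.2)) atTop = 0}

/-- The pairs `(x, y)` with `limsup d(fⁿ x, fⁿ y) > ε`. -/
def separatedPairs {X : Type*} [MetricSpace X] [CompactSpace X] (f : C(X, X)) (ε : ℝ) :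
    Set (X × X) :=
  {p | limsup (fun n : ℕ => dist (f^[n] p.1) (f^[n] p.2)) atTop > ε}

/-- The set of Li-Yorke pairs of `f`. -/
def liYorkePairs {X : Type*} [MetricSpace X] [CompactSpace X] (f : C(X, X)) : Set (X × X) :=
  proximalPairs f ∩ separatedPairs f 0

/-- The set of `ε`-Li-Yorke pairs of `f`. -/
def epsLiYorkePairs {X : Type*} [MetricSpace X] [CompactSpace X] (f : C(X, X)) (ε : ℝ) :
    Set (X × X) :=
  proximalPairs f ∩ separatedPairs f ε

/-- `f` is generically chaotic: its Li-Yorke pairs are residual (comeagre) in `X × X`. -/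
def GenericallyChaotic {X : Type*} [MetricSpace X] [CompactSpace X] (f : C(X, X)) : Prop :=
  liYorkePairs f ∈ residual (X × X)

/-- `f` is generically `ε`-chaotic: its `ε`-Li-Yorke pairs are residual (comeagre) in `X × X`. -/
def GenericallyEpsChaotic {X : Type*} [MetricSpace X] [CompactSpace X] (f : C(X, X)) (ε : ℝ) :
    Prop :=
  epsLiYorkePairs f ε ∈ residual (X × X)

/-- The map `K ↦ f(K)` on the space of non-empty compact subsets of `X`, which carries the
Hausdorff metric. -/
def inducedMap {X : Type*} [MetricSpace X] (f : C(X, X)) :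
    C(NonemptyCompacts X, NonemptyCompacts X) where
  toFun := NonemptyCompacts.map f f.continuous
  continuous_toFun := f.continuous.nonemptyCompacts_map

end

/-! ### Images of intervals under iterates of an interval map -/

section IntervalDynamics

open Set Topology unitInterval

/-! Everything is reduced to two properties of intervals: any two are proximal, and each spreads.
Applied to small open boxes, Baire's theorem extracts both from generic chaos of `f` or of the
induced map; `IsSetRepresentation` treats the two systems at once.

Conversely, if all intervals are pairwise proximal and spread beyond one constant `ε' > ε`, the
induced map is generically `ε`-chaotic (`genericallyEpsChaotic_inducedMap`). Since finite sets are
dense in the hyperspace, it suffices to move finitely many points inside given intervals.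
Self-covering images upgrade proximality at some times to closeness at all late times
(`eventually_close`), and a one-dimensional Helly argument then brings all the points together. For
separation, one point must be far from points chosen in all the other intervals
(`frequently_exists_separated`); the order of the line leaves no obstruction except two intervals
that stay apart, which closeness forbids.

It remains to make the spread uniform. If each interval spreads by more than a given `ε`, finitely
many test intervals suffice, so the first claim keeps its `ε`. If each only spreads by some positive
amount (`exists_uniform_spread_of_not_trapped`), failure of uniformity yields arbitrarily small
interval orbits, which accumulate at a fixed point `x₀`. An interval then exists in which generic
points converge to `x₀`, contradicting the positive limsup (`not_trapped`). -/

/-- The images of `J` under infinitely many iterates of `f` have diameter more than `ε`. -/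
def SpreadsBeyond (f : I → I) (ε : ℝ) (J : Set I) : Prop :=
  ∃ᶠ t in atTop, ∃ x ∈ J, ∃ y ∈ J, ε < dist (f^[t] x) (f^[t] y)

/-- The images of `J` and `K` under the iterates of `f` come arbitrarily close infinitely often. -/
def ProximalSets (f : I → I) (J K : Set I) : Prop :=
  ∀ δ > 0, ∃ᶠ t in atTop, ∃ x ∈ J, ∃ y ∈ K, dist (f^[t] x) (f^[t] y) < δ

theorem SpreadsBeyond.mono {f : I → I} {ε ε' : ℝ} {J K : Set I} (h : SpreadsBeyond f ε J)
    (hε : ε' ≤ ε) (hJK : J ⊆ K) : SpreadsBeyond f ε' K :=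
  Frequently.mono h fun _ ⟨x, hx, y, hy, hxy⟩ => ⟨x, hJK hx, y, hJK hy, hε.trans_lt hxy⟩

theorem ProximalSets.mono {f : I → I} {J K J' K' : Set I} (h : ProximalSets f J K)
    (hJ : J ⊆ J') (hK : K ⊆ K') : ProximalSets f J' K' := fun δ hδ =>
  (h δ hδ).mono fun _ ⟨x, hx, y, hy, hxy⟩ => ⟨x, hJ hx, y, hK hy, hxy⟩

theorem SpreadsBeyond.of_image {f : I → I} {ε : ℝ} {J : Set I} {s : ℕ}
    (h : SpreadsBeyond f ε (f^[s] '' J)) : SpreadsBeyond f ε J := by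
  rw [SpreadsBeyond, frequently_atTop] at h ⊢
  intro N
  obtain ⟨t, ht, x, ⟨x', hx', rfl⟩, y, ⟨y', hy', rfl⟩, hxy⟩ := h N
  refine ⟨t + s, by omega, x', hx', y', hy', ?_⟩
  rwa [Function.iterate_add_apply, Function.iterate_add_apply]

/-- An iterate that collapsed `J` to a point would prevent all later separation. Hence images of
spreading intervals remain nondegenerate. -/
theorem SpreadsBeyond.exists_ne {f : I → I} {ε : ℝ} {J : Set I} (h : SpreadsBeyond f ε J)
    (hε : 0 ≤ ε) (t : ℕ) : ∃ x ∈ J, ∃ y ∈ J, f^[t] x ≠ f^[t] y := by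
  obtain ⟨s, hs, x, hx, y, hy, hxy⟩ := frequently_atTop.1 h t
  refine ⟨x, hx, y, hy, fun he => ?_⟩
  have : f^[s] x = f^[s] y := by
    rw [← Nat.sub_add_cancel hs, Function.iterate_add_apply, Function.iterate_add_apply, he]
  rw [this, dist_self] at hxy
  linarith

theorem exists_Icc_subset_image {g : I → I} (hg : Continuous g) {J : Set I} (hJ : IsPreconnected J)
    {x y : I} (hx : x ∈ J) (hy : y ∈ J) (hxy : g x ≠ g y) :
    ∃ c d, c < d ∧ Icc c d ⊆ g '' J ∧ dist c d = dist (g x) (g y) := by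
  have hc := hJ.image g hg.continuousOn
  rcases lt_or_gt_of_ne hxy with h | h
  · exact ⟨_, _, h, hc.Icc_subset (mem_image_of_mem g hx) (mem_image_of_mem g hy), rfl⟩
  · exact ⟨_, _, h, hc.Icc_subset (mem_image_of_mem g hy) (mem_image_of_mem g hx), dist_comm _ _⟩

theorem exists_Icc_subset_of_isOpen {U : Set I} (hU : IsOpen U) (hne : U.Nonempty) :
    ∃ a b, a < b ∧ Icc a b ⊆ U := by
  obtain ⟨x, hx⟩ := hne
  rcases eq_or_ne x 1 with rfl | h1
  · obtain ⟨l, hl, hlU⟩ := exists_Ioc_subset_of_mem_nhds (hU.mem_nhds hx) ⟨0, zero_lt_one⟩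
    obtain ⟨m, hm, hm'⟩ := exists_between hl
    exact ⟨m, 1, hm', fun y hy => hlU ⟨hm.trans_le hy.1, hy.2⟩⟩
  · have : x < 1 := lt_of_le_of_ne unitInterval.le_one' h1
    obtain ⟨l, hl, hlU⟩ := exists_Ico_subset_of_mem_nhds (hU.mem_nhds hx) ⟨1, this⟩
    obtain ⟨m, hm, hm'⟩ := exists_between hl
    exact ⟨x, m, hm, fun y hy => hlU ⟨hy.1, hy.2.trans_lt hm'⟩⟩

/-- If a point of `[a, b]` is mapped into an open set, so is a whole subinterval. -/
theorem exists_Icc_subset_preimage {g : I → I} (hg : Continuous g) {a b x : I} (hab : a < b)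
    (hx : x ∈ Icc a b) {V : Set I} (hV : IsOpen V) (hxV : g x ∈ V) :
    ∃ c d, c < d ∧ Icc c d ⊆ Icc a b ∧ ∀ y ∈ Icc c d, g y ∈ V := by
  rw [← closure_Ioo hab.ne] at hx
  obtain ⟨c, d, hcd, h⟩ := exists_Icc_subset_of_isOpen ((hV.preimage hg).inter isOpen_Ioo)
    (mem_closure_iff.1 hx _ (hV.preimage hg) hxV)
  exact ⟨c, d, hcd, fun y hy => Ioo_subset_Icc_self (h hy).2, fun y hy => (h hy).1⟩

/-- Finitely many intervals suffice to refine all the intervals longer than `ε`. -/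
theorem exists_finset_Icc {ε : ℝ} (hε : 0 < ε) : ∃ K : Finset (I × I), (∀ p ∈ K, p.1 < p.2) ∧
    ∀ x y : I, x < y → ε < dist x y → ∃ p ∈ K, Icc p.1 p.2 ⊆ Icc x y := by
  -- With mesh `1 / n < ε / 2`, an interval longer than `ε` contains a whole cell.
  obtain ⟨n, hn⟩ := exists_nat_gt (2 / ε)
  have hn0 : (0 : ℝ) < n := lt_trans (by positivity) hn
  have hnε : 2 < ε * n := by rwa [div_lt_iff₀' hε] at hn
  let g : ℕ → I := fun i => projIcc 0 1 zero_le_one ((i : ℝ) / n)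
  refine ⟨((Finset.range n).image fun i => (g i, g (i + 1))).filter fun p => p.1 < p.2,
    fun p hp => (Finset.mem_filter.1 hp).2, fun x y hxy h => ?_⟩
  have hd : ε < (y : ℝ) - x := by
    have hxy' : (x : ℝ) < y := hxy
    rwa [Subtype.dist_eq, dist_comm, Real.dist_eq, abs_of_pos (by linarith)] at h
  set i := ⌈(x : ℝ) * n⌉₊ with hi
  have h1 : (x : ℝ) * n ≤ i := Nat.le_ceil _
  have h2 : (i : ℝ) < x * n + 1 := Nat.ceil_lt_add_one (mul_nonneg x.2.1 hn0.le)
  have hy1 := y.2.2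
  have hx0 := x.2.1
  have h3 : (i : ℝ) + 1 < y * n := by nlinarith
  have h4 : (i : ℝ) + 1 < n := by nlinarith
  have e1 : ((g i : I) : ℝ) = i / n := by
    have : (i : ℝ) / n ∈ Icc (0 : ℝ) 1 :=
      ⟨by positivity, by rw [div_le_one hn0]; linarith⟩
    simp only [g, projIcc_of_mem _ this]
  have e2 : ((g (i + 1) : I) : ℝ) = (i + 1) / n := by
    have : ((i + 1 : ℕ) : ℝ) / n ∈ Icc (0 : ℝ) 1 :=
      ⟨by positivity, by rw [div_le_one hn0]; push_cast; linarith⟩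
    simp only [g, projIcc_of_mem _ this]
    push_cast; rfl
  refine ⟨(g i, g (i + 1)), Finset.mem_filter.2 ⟨Finset.mem_image.2 ⟨i, ?_, rfl⟩, ?_⟩,
    Icc_subset_Icc ?_ ?_⟩
  · rw [Finset.mem_range]; exact_mod_cast (by linarith : (i : ℝ) < n)
  · change ((g i : I) : ℝ) < (g (i + 1) : I)
    rw [e1, e2]; gcongr; linarith
  · change (x : ℝ) ≤ (g i : I)
    rw [e1, le_div_iff₀ hn0]; exact h1
  · change ((g (i + 1) : I) : ℝ) ≤ y
    rw [e2, div_le_iff₀ hn0]; exact h3.le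

theorem exists_dist_iterate_lt {f : I → I} (hf : Continuous f) (M : ℕ) {δ : ℝ} (hδ : 0 < δ) :
    ∃ η > 0, ∀ x y : I, dist x y < η → ∀ i ≤ M, dist (f^[i] x) (f^[i] y) < δ := by
  have h : ∀ i, ∀ᶠ p in uniformity I, dist (f^[i] p.1) (f^[i] p.2) < δ := fun i =>
    (CompactSpace.uniformContinuous_of_continuous (hf.iterate i)) (Metric.dist_mem_uniformity hδ)
  have h' := (eventually_all_finset (Finset.range (M + 1))).2 fun i _ => h i
  obtain ⟨η, hη, H⟩ := Metric.mem_uniformity_dist.1 h'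
  exact ⟨η, hη, fun x y hxy i hi => H hxy i (Finset.mem_range.2 (by omega))⟩

/-- A family of interval spreads is automatically uniform. -/
theorem exists_uniform_spread {f : I → I} (hf : Continuous f) {ε : ℝ} (hε : 0 < ε)
    (H : ∀ a b, a < b → ∃ ε' > ε, SpreadsBeyond f ε' (Icc a b)) :
    ∃ ε' > ε, ∀ a b, a < b → SpreadsBeyond f ε' (Icc a b) := by
  obtain ⟨K, hK, hKε⟩ := exists_finset_Icc hε
  -- One `e` slightly above `ε` serves all of `K`. Any other interval has an image longer than `ε`,
  -- which covers a member of `K` and so inherits `e`.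
  have : ∀ p ∈ K, ∀ᶠ e in 𝓝[>] ε, SpreadsBeyond f e (Icc p.1 p.2) := fun p hp => by
    obtain ⟨ε', hε', h⟩ := H p.1 p.2 (hK p hp)
    filter_upwards [Ioo_mem_nhdsGT hε'] with e he using h.mono he.2.le subset_rfl
  obtain ⟨e, he, heε⟩ := (((eventually_all_finset K).2 this).and self_mem_nhdsWithin).exists
  refine ⟨e, heε, fun a b hab => ?_⟩
  obtain ⟨ε', hε', h⟩ := H a b hab
  obtain ⟨t, x, hx, y, hy, hxy⟩ := h.exists
  obtain ⟨c, d, hcd, hsub, hdist⟩ := exists_Icc_subset_image (hf.iterate t) isPreconnected_Icc hx hy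
    (dist_pos.1 (hε.trans (lt_trans hε' hxy)))
  obtain ⟨p, hp, hps⟩ := hKε c d hcd (by rw [hdist]; exact lt_trans hε' hxy)
  exact ((he p hp).mono le_rfl (hps.trans hsub)).of_image

theorem iterate_image_add (f : I → I) (m n : ℕ) (J : Set I) :
    f^[m + n] '' J = f^[m] '' (f^[n] '' J) := by
  rw [Function.iterate_add, image_comp]

theorem subset_iterate_mul {f : I → I} {n : ℕ} {Q : Set I} (h : Q ⊆ f^[n] '' Q) (j : ℕ) :
    Q ⊆ f^[n * j] '' Q := by
  induction j with
  | zero => simp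
  | succ j ih =>
    rw [Nat.mul_succ, add_comm, iterate_image_add]
    exact h.trans (image_mono ih)

/-- If all intervals spread by `ε`, some image of each of them contains an interval that is covered
by one of its own images. -/
theorem exists_self_covering {f : I → I} (hf : Continuous f) {ε : ℝ} (hε : 0 < ε)
    (H : ∀ a b, a < b → SpreadsBeyond f ε (Icc a b)) {a b : I} (hab : a < b) :
    ∃ s n c d, 0 < n ∧ c < d ∧ Icc c d ⊆ f^[s] '' Icc a b ∧ Icc c d ⊆ f^[n] '' Icc c d := by
  obtain ⟨K, hK, hKε⟩ := exists_finset_Icc hε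
  have step : ∀ a b, a < b → ∃ t > 0, ∃ p ∈ K, Icc p.1 p.2 ⊆ f^[t] '' Icc a b := by
    intro a b hab
    obtain ⟨t, ht, x, hx, y, hy, hxy⟩ := frequently_atTop.1 (H a b hab) 1
    obtain ⟨c, d, hcd, hsub, hdist⟩ := exists_Icc_subset_image (hf.iterate t) isPreconnected_Icc
      hx hy (dist_pos.1 (hε.trans hxy))
    obtain ⟨p, hp, hps⟩ := hKε c d hcd (by rw [hdist]; exact hxy)
    exact ⟨t, ht, p, hp, hps.trans hsub⟩
  obtain ⟨t₀, -, p₀, hp₀, h₀⟩ := step a b hab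
  have step' : ∀ p : K, ∃ t > 0, ∃ q : K, Icc q.1.1 q.1.2 ⊆ f^[t] '' Icc p.1.1 p.1.2 := fun p => by
    obtain ⟨t, ht, q, hq, h⟩ := step p.1.1 p.1.2 (hK _ p.2)
    exact ⟨t, ht, ⟨q, hq⟩, h⟩
  choose τ hτ nxt hnxt using step'
  -- A path in the finite covering graph on `K` must revisit a vertex; the loop is the self-covering
  -- interval.
  let c : ℕ → K := fun n => nxt^[n] ⟨p₀, hp₀⟩
  have hstep : ∀ n k, ∃ t ≥ k, Icc (c (n + k)).1.1 (c (n + k)).1.2 ⊆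
      f^[t] '' Icc (c n).1.1 (c n).1.2 := by
    intro n k
    induction k with
    | zero => exact ⟨0, le_rfl, by simp⟩
    | succ k ih =>
      obtain ⟨t, ht, h⟩ := ih
      refine ⟨τ (c (n + k)) + t, by have := hτ (c (n + k)); omega, ?_⟩
      rw [iterate_image_add, ← add_assoc]
      have e : c (n + k + 1) = nxt (c (n + k)) := Function.iterate_succ_apply' _ _ _
      rw [e]
      exact (hnxt _).trans (image_mono h)
  obtain ⟨m, n, hmn, hc⟩ : ∃ m n, m < n ∧ c m = c n := by
    obtain ⟨m, n, hne, h⟩ := Finite.exists_ne_map_eq_of_infinite c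
    rcases lt_or_gt_of_ne hne with h' | h'
    exacts [⟨m, n, h', h⟩, ⟨n, m, h', h.symm⟩]
  obtain ⟨t, -, ht⟩ := hstep 0 m
  obtain ⟨t', ht', h'⟩ := hstep m (n - m)
  rw [Nat.add_sub_cancel' hmn.le, ← hc] at h'
  rw [zero_add] at ht
  refine ⟨t + t₀, t', _, _, by omega, hK _ (c m).2, ?_, h'⟩
  rw [iterate_image_add]
  exact ht.trans (image_mono h₀)

/-- If all intervals spread by `ε` and all pairs of intervals are proximal, then the distance of
the images of two intervals tends to zero. -/
theorem eventually_close {f : I → I} (hf : Continuous f) {ε : ℝ} (hε : 0 < ε)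
    (H : ∀ a b, a < b → SpreadsBeyond f ε (Icc a b))
    (hprox : ∀ a b c d, a < b → c < d → ProximalSets f (Icc a b) (Icc c d))
    {a b c d : I} (hab : a < b) (hcd : c < d) {δ : ℝ} (hδ : 0 < δ) :
    ∀ᶠ t in atTop, ∃ x ∈ Icc a b, ∃ y ∈ Icc c d, dist (f^[t] x) (f^[t] y) < δ := by
  obtain ⟨s, n, p, q, hn, hpq, h1, h2⟩ := exists_self_covering hf hε H hab
  obtain ⟨s', n', p', q', hn', hpq', h1', h2'⟩ := exists_self_covering hf hε H hcd
  -- The delays are crossed so that `Q` and `Q'` both lie in images at the same time `s + s'`; `M`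
  -- is a common return time.
  let Q := f^[s'] '' Icc p q
  let Q' := f^[s] '' Icc p' q'
  let M := n * n'
  have hM : 0 < M := Nat.mul_pos hn hn'
  have hQJ : Q ⊆ f^[s + s'] '' Icc a b := by
    rw [add_comm, iterate_image_add]; exact image_mono h1
  have hQJ' : Q' ⊆ f^[s + s'] '' Icc c d := by
    rw [iterate_image_add]; exact image_mono h1'
  have hQ : Q ⊆ f^[M] '' Q := by
    rw [← iterate_image_add, add_comm, iterate_image_add]
    exact image_mono (subset_iterate_mul h2 _)
  have hQ' : Q' ⊆ f^[M] '' Q' := by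
    rw [← iterate_image_add, add_comm, iterate_image_add]
    have := subset_iterate_mul h2' n
    rw [mul_comm n' n] at this
    exact image_mono this
  let D : ℝ → ℕ → Prop := fun η t => ∃ x ∈ Q, ∃ y ∈ Q', dist (f^[t] x) (f^[t] y) < η
  -- Self-covering allows close points to be pulled back by `M` steps, so closeness recurs with
  -- period `M`. Uniform continuity fills the times in between.
  have hD : ∀ η t, D η t → D η (t + M) := by
    rintro η t ⟨x, hx, y, hy, hxy⟩
    obtain ⟨x', hx', rfl⟩ := hQ hx
    obtain ⟨y', hy', rfl⟩ := hQ' hy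
    refine ⟨x', hx', y', hy', ?_⟩
    rwa [Function.iterate_add_apply, Function.iterate_add_apply]
  obtain ⟨η, hη, hηδ⟩ := exists_dist_iterate_lt hf M hδ
  obtain ⟨t₀, ht₀⟩ : ∃ t, D η t := by
    obtain ⟨x, hx, y, hy, hxy⟩ := (H p q hpq).exists_ne hε.le s'
    obtain ⟨u, v, huv, huv', -⟩ := exists_Icc_subset_image (hf.iterate s') isPreconnected_Icc
      hx hy hxy
    obtain ⟨x, hx, y, hy, hxy⟩ := (H p' q' hpq').exists_ne hε.le s
    obtain ⟨u', v', huv1, huv1', -⟩ := exists_Icc_subset_image (hf.iterate s) isPreconnected_Icc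
      hx hy hxy
    exact (((hprox u v u' v' huv huv1).mono huv' huv1') η hη).exists
  have hall : ∀ r, D δ (t₀ + r) := by
    intro r
    induction r using Nat.strong_induction_on with
    | _ r ih =>
      by_cases hr : r ≤ M
      · obtain ⟨x, hx, y, hy, hxy⟩ := ht₀
        refine ⟨x, hx, y, hy, ?_⟩
        rw [add_comm, Function.iterate_add_apply, Function.iterate_add_apply]
        exact hηδ _ _ hxy r hr
      · have := hD δ _ (ih (r - M) (by omega))
        rwa [show t₀ + (r - M) + M = t₀ + r by omega] at this
  filter_upwards [eventually_ge_atTop (t₀ + (s + s'))] with t ht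
  obtain ⟨x, hx, y, hy, hxy⟩ := hall (t - (t₀ + (s + s')))
  obtain ⟨x', hx', rfl⟩ := hQJ hx
  obtain ⟨y', hy', rfl⟩ := hQJ' hy
  refine ⟨x', hx', y', hy', ?_⟩
  rwa [← Function.iterate_add_apply, ← Function.iterate_add_apply,
    show t₀ + (t - (t₀ + (s + s'))) + (s + s') = t by omega] at hxy

end IntervalDynamics

/-! ### Bringing together and separating finitely many intervals -/

section IntervalFamilies

open Set Topology unitInterval

variable {ι : Type*} {f : I → I} {ε : ℝ} {a b : ι → I}

/-- Eventually, finitely many intervals have images that are simultaneously close to one point. -/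
theorem eventually_exists_common_point (hf : Continuous f) (hε : 0 < ε)
    (H : ∀ a b, a < b → SpreadsBeyond f ε (Icc a b))
    (hprox : ∀ a b c d, a < b → c < d → ProximalSets f (Icc a b) (Icc c d))
    (hab : ∀ i, a i < b i) (F : Finset ι) (hF : F.Nonempty) {δ : ℝ} (hδ : 0 < δ) :
    ∀ᶠ t in atTop, ∃ p, ∃ x : ι → I, ∀ i ∈ F, x i ∈ Icc (a i) (b i) ∧ dist (f^[t] (x i)) p < δ := by
  have h : ∀ᶠ t in atTop, ∀ i ∈ F, ∀ j ∈ F, ∃ x ∈ Icc (a i) (b i), ∃ y ∈ Icc (a j) (b j),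
      dist (f^[t] x) (f^[t] y) < δ :=
    (eventually_all_finset F).2 fun i _ => (eventually_all_finset F).2 fun j _ =>
      eventually_close hf hε H hprox (hab i) (hab j) hδ
  filter_upwards [h] with t ht
  have hmin : ∀ i, ∃ m ∈ Icc (a i) (b i), ∀ y ∈ Icc (a i) (b i), f^[t] m ≤ f^[t] y := fun i => by
    obtain ⟨m, hm, h⟩ := isCompact_Icc.exists_isMinOn (nonempty_Icc.2 (hab i).le)
      (hf.iterate t).continuousOn
    exact ⟨m, hm, fun y hy => h hy⟩
  choose m hm hmle using hmin
  -- The common point is the largest of the minima of the images. Each image either contains it, by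
  -- the intermediate value theorem, or approaches it from below.
  obtain ⟨i₀, hi₀, hmax⟩ := F.exists_max_image (fun i => f^[t] (m i)) hF
  have key : ∀ i ∈ F, ∃ x ∈ Icc (a i) (b i), dist (f^[t] x) (f^[t] (m i₀)) < δ := by
    intro i hi
    obtain ⟨y, hy, z, hz, hyz⟩ := ht i hi i₀ hi₀
    rcases le_total (f^[t] y) (f^[t] (m i₀)) with hle | hle
    · refine ⟨y, hy, lt_of_le_of_lt ?_ hyz⟩
      have h1 : (f^[t] y : ℝ) ≤ f^[t] (m i₀) := hle
      have h2 : (f^[t] (m i₀) : ℝ) ≤ f^[t] z := hmle _ _ hz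
      rw [Subtype.dist_eq, Subtype.dist_eq, Real.dist_eq, Real.dist_eq,
        abs_of_nonpos (by linarith), abs_of_nonpos (by linarith)]
      linarith
    · obtain ⟨x, hx, hxe⟩ := (isPreconnected_Icc.image _ (hf.iterate t).continuousOn).Icc_subset
        (mem_image_of_mem _ (hm i)) (mem_image_of_mem _ hy) ⟨hmax i hi, hle⟩
      exact ⟨x, hx, by rwa [hxe, dist_self]⟩
  choose! x hx using key
  exact ⟨_, x, hx⟩

/-- Any interval has a subinterval which, compared with each of finitely many intervals, either
is eventually absorbed by it or never overlaps it. -/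
theorem exists_subinterval_dichotomy (hf : Continuous f) (F : Finset ι) {u v : I} (huv : u < v) :
    ∃ u' v', u' < v' ∧ Icc u' v' ⊆ Icc u v ∧ ∀ j ∈ F,
      (∃ T, f^[T] '' Icc u' v' ⊆ f^[T] '' Icc (a j) (b j)) ∨
      ∀ t p q, p < q → ¬ Icc p q ⊆ f^[t] '' Icc u' v' ∩ f^[t] '' Icc (a j) (b j) := by
  classical
  induction F using Finset.induction_on with
  | empty => exact ⟨u, v, huv, subset_rfl, by simp⟩
  | insert k F hk ih =>
    obtain ⟨u', v', huv', hsub, hF⟩ := ih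
    have inherit : ∀ u₁ v₁, Icc u₁ v₁ ⊆ Icc u' v' → ∀ j ∈ F,
        (∃ T, f^[T] '' Icc u₁ v₁ ⊆ f^[T] '' Icc (a j) (b j)) ∨
        ∀ t p q, p < q → ¬ Icc p q ⊆ f^[t] '' Icc u₁ v₁ ∩ f^[t] '' Icc (a j) (b j) := by
      intro u₁ v₁ h₁ j hj
      rcases hF j hj with ⟨T, hT⟩ | h
      · exact .inl ⟨T, (image_mono h₁).trans hT⟩
      · exact .inr fun t p q hpq hs => h t p q hpq
          (hs.trans (inter_subset_inter_left _ (image_mono h₁)))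
    by_cases hov : ∀ t p q, p < q → ¬ Icc p q ⊆ f^[t] '' Icc u' v' ∩ f^[t] '' Icc (a k) (b k)
    · refine ⟨u', v', huv', hsub, fun j hj => ?_⟩
      rcases Finset.mem_insert.1 hj with rfl | hj
      · exact .inr hov
      · exact hF j hj
    -- If an overlap occurs at time `t`, shrink to a subinterval that `f^[t]` sends into it; this
    -- gives absorption by the `k`-th interval.
    · push Not at hov
      obtain ⟨t, p, q, hpq, hs⟩ := hov
      obtain ⟨r, hpr, hrq⟩ := exists_between hpq
      obtain ⟨z, hz, hzr⟩ := (hs ⟨hpr.le, hrq.le⟩).1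
      obtain ⟨u₁, v₁, huv₁, hsub₁, himg⟩ := exists_Icc_subset_preimage (hf.iterate t) huv' hz
        (isOpen_Ioo (a := p) (b := q)) (hzr ▸ ⟨hpr, hrq⟩)
      refine ⟨u₁, v₁, huv₁, hsub₁.trans hsub, fun j hj => ?_⟩
      rcases Finset.mem_insert.1 hj with rfl | hj
      · refine .inl ⟨t, ?_⟩
        rintro _ ⟨y, hy, rfl⟩
        exact (hs (Ioo_subset_Icc_self (himg y hy))).2
      · exact inherit _ _ hsub₁ j hj

/-- Infinitely often, some point of a given interval is far from points chosen in finitely many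
other intervals. -/
theorem frequently_exists_separated (hf : Continuous f) (hε : 0 < ε)
    (H : ∀ a b, a < b → SpreadsBeyond f ε (Icc a b))
    (hprox : ∀ a b c d, a < b → c < d → ProximalSets f (Icc a b) (Icc c d))
    (hab : ∀ i, a i < b i) (F : Finset ι) {u v : I} (huv : u < v) :
    ∃ᶠ t in atTop, ∃ x ∈ Icc u v, ∃ y : ι → I, ∀ j ∈ F, y j ∈ Icc (a j) (b j) ∧
      ε < dist (f^[t] x) (f^[t] (y j)) := by
  obtain ⟨u', v', huv', hsub, hF⟩ := exists_subinterval_dichotomy (a := a) (b := b) hf F huv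
  have hclose : ∀ᶠ t in atTop, ∀ i ∈ F, ∀ j ∈ F, ∃ x ∈ Icc (a i) (b i), ∃ y ∈ Icc (a j) (b j),
      dist (f^[t] x) (f^[t] y) < ε :=
    (eventually_all_finset F).2 fun i _ => (eventually_all_finset F).2 fun j _ =>
      eventually_close hf hε H hprox (hab i) (hab j) hε
  have hdich : ∀ᶠ t in atTop, ∀ j ∈ F, f^[t] '' Icc u' v' ⊆ f^[t] '' Icc (a j) (b j) ∨
      ∀ p q, p < q → ¬ Icc p q ⊆ f^[t] '' Icc u' v' ∩ f^[t] '' Icc (a j) (b j) := by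
    refine (eventually_all_finset F).2 fun j hj => ?_
    rcases hF j hj with ⟨T, hT⟩ | h
    · filter_upwards [eventually_ge_atTop T] with t ht
      left
      rw [← Nat.sub_add_cancel ht, iterate_image_add, iterate_image_add]
      exact image_mono hT
    · exact .of_forall fun t => .inr (h t)
  refine ((H u' v' huv').and_eventually (hclose.and hdich)).mono ?_
  rintro t ⟨⟨x₀, hx₀, y₀, hy₀, hxy₀⟩, hcl, hdi⟩
  obtain ⟨x, hx, y, hy, hlt, hxy⟩ : ∃ x ∈ Icc u' v', ∃ y ∈ Icc u' v', f^[t] x < f^[t] y ∧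
      ε < dist (f^[t] x) (f^[t] y) := by
    rcases lt_trichotomy (f^[t] x₀) (f^[t] y₀) with h | h | h
    · exact ⟨x₀, hx₀, y₀, hy₀, h, hxy₀⟩
    · rw [h, dist_self] at hxy₀; linarith
    · exact ⟨y₀, hy₀, x₀, hx₀, h, by rwa [dist_comm]⟩
  have hlt' : (f^[t] x : ℝ) < f^[t] y := hlt
  have hd : ε < (f^[t] y : ℝ) - f^[t] x := by
    rwa [Subtype.dist_eq, dist_comm, Real.dist_eq, abs_of_pos (by linarith)] at hxy
  have hcon : ∀ J : Set I, IsPreconnected J → OrdConnected (f^[t] '' J) := fun J hJ =>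
    (hJ.image _ (hf.iterate t).continuousOn).ordConnected
  have hc := hcon _ (isPreconnected_Icc (a := u') (b := v'))
  have hxm : f^[t] x ∈ f^[t] '' Icc u' v' := mem_image_of_mem _ hx
  have hym : f^[t] y ∈ f^[t] '' Icc u' v' := mem_image_of_mem _ hy
  -- If every image reaches left of `f^[t] x`, the point `y` is far from suitable points of all of
  -- them; if every image reaches right of `f^[t] y`, so is `x`. Otherwise some image avoids the
  -- left side and some image avoids the right side.
  by_cases hL : ∀ j ∈ F, ∃ w ∈ Icc (a j) (b j), f^[t] w ≤ f^[t] x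
  · choose! w hw using hL
    refine ⟨y, hsub hy, w, fun j hj => ⟨(hw j hj).1, ?_⟩⟩
    have h1 : (f^[t] (w j) : ℝ) ≤ f^[t] x := (hw j hj).2
    rw [Subtype.dist_eq, Real.dist_eq, abs_of_pos (by linarith)]
    linarith
  by_cases hR : ∀ j ∈ F, ∃ w ∈ Icc (a j) (b j), f^[t] y ≤ f^[t] w
  · choose! w hw using hR
    refine ⟨x, hsub hx, w, fun j hj => ⟨(hw j hj).1, ?_⟩⟩
    have h1 : (f^[t] y : ℝ) ≤ f^[t] (w j) := (hw j hj).2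
    rw [Subtype.dist_eq, dist_comm, Real.dist_eq, abs_of_pos (by linarith)]
    linarith
  exfalso
  push Not at hL hR
  obtain ⟨j, hj, hjx⟩ := hL
  obtain ⟨k, hk, hky⟩ := hR
  -- the image of the `j`-th interval lies to the right of `f^[t] y`
  have hj' : ∀ z ∈ Icc (a j) (b j), f^[t] y ≤ f^[t] z := by
    intro z hz
    by_contra! hzy
    rcases hdi j hj with h | h
    · obtain ⟨w, hw, hwx⟩ := h hxm
      exact (hjx w hw).ne' hwx
    -- The `j`-th image is nondegenerate, so a point of it left of `f^[t] y` would produce a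
    -- forbidden overlap.
    · obtain ⟨s, hs, s', hs', hss'⟩ := (H _ _ (hab j)).exists_ne hε.le t
      obtain ⟨w, hw, hwz⟩ : ∃ w ∈ Icc (a j) (b j), f^[t] w ≠ f^[t] z := by
        by_cases hsz : f^[t] s = f^[t] z
        · exact ⟨s', hs', fun h => hss' (hsz.trans h.symm)⟩
        · exact ⟨s, hs, hsz⟩
      have hcj := hcon _ (isPreconnected_Icc (a := a j) (b := b j))
      have hzx := hjx z hz
      rcases lt_or_gt_of_ne hwz with hlt2 | hlt2
      · refine h _ _ hlt2 (subset_inter ?_ (hcj.out ⟨w, hw, rfl⟩ ⟨z, hz, rfl⟩))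
        exact (Icc_subset_Icc (hjx w hw).le hzy.le).trans (hc.out hxm hym)
      · refine h (f^[t] z) (min (f^[t] w) (f^[t] y)) (lt_min hlt2 hzy) (subset_inter ?_ ?_)
        · exact (Icc_subset_Icc hzx.le (min_le_right _ _)).trans (hc.out hxm hym)
        · exact (Icc_subset_Icc le_rfl (min_le_left _ _)).trans (hcj.out ⟨z, hz, rfl⟩ ⟨w, hw, rfl⟩)
  have hk' : ∀ z ∈ Icc (a k) (b k), f^[t] z ≤ f^[t] x := by
    intro z hz
    by_contra! hzx
    rcases hdi k hk with h | h
    · obtain ⟨w, hw, hwy⟩ := h hym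
      exact (hky w hw).ne hwy
    · obtain ⟨s, hs, s', hs', hss'⟩ := (H _ _ (hab k)).exists_ne hε.le t
      obtain ⟨w, hw, hwz⟩ : ∃ w ∈ Icc (a k) (b k), f^[t] w ≠ f^[t] z := by
        by_cases hsz : f^[t] s = f^[t] z
        · exact ⟨s', hs', fun h => hss' (hsz.trans h.symm)⟩
        · exact ⟨s, hs, hsz⟩
      have hck := hcon _ (isPreconnected_Icc (a := a k) (b := b k))
      have hzy := hky z hz
      rcases lt_or_gt_of_ne hwz with hlt2 | hlt2
      · refine h (max (f^[t] w) (f^[t] x)) (f^[t] z) (max_lt hlt2 hzx) (subset_inter ?_ ?_)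
        · exact (Icc_subset_Icc (le_max_right _ _) hzy.le).trans (hc.out hxm hym)
        · exact (Icc_subset_Icc (le_max_left _ _) le_rfl).trans (hck.out ⟨w, hw, rfl⟩ ⟨z, hz, rfl⟩)
      · refine h _ _ hlt2 (subset_inter ?_ (hck.out ⟨z, hz, rfl⟩ ⟨w, hw, rfl⟩))
        exact (Icc_subset_Icc hzx.le (hky w hw).le).trans (hc.out hxm hym)
  obtain ⟨z, hz, w, hw, hzw⟩ := hcl j hj k hk
  have h1 : (f^[t] y : ℝ) ≤ f^[t] z := hj' z hz
  have h2 : (f^[t] w : ℝ) ≤ f^[t] x := hk' w hw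
  rw [Subtype.dist_eq, Real.dist_eq, abs_of_pos (by linarith)] at hzw
  linarith

end IntervalFamilies

/-! ### Finite approximation and Baire category in the hyperspace -/

section Hyperspace

open Set Topology unitInterval

theorem coe_inducedMap_iterate {X : Type*} [MetricSpace X] (f : C(X, X)) (n : ℕ)
    (A : NonemptyCompacts X) : ((inducedMap f)^[n] A : Set X) = f^[n] '' A := by
  induction n with
  | zero => simp
  | succ n ih =>
    rw [Function.iterate_succ_apply', Function.iterate_succ', image_comp, ← ih]
    rfl

theorem frequently_dist_lt_of_mem_proximalPairs {X : Type*} [MetricSpace X] [CompactSpace X]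
    {f : C(X, X)} {p : X × X} (hp : p ∈ proximalPairs f) {δ : ℝ} (hδ : 0 < δ) :
    ∃ᶠ n in atTop, dist (f^[n] p.1) (f^[n] p.2) < δ := by
  refine frequently_lt_of_liminf_lt ?_ (lt_of_eq_of_lt hp hδ)
  exact IsCoboundedUnder.of_frequently_le (a := Metric.diam (univ : Set X))
    (Frequently.of_forall fun n => Metric.dist_le_diam_of_mem
      (Metric.isBounded_of_compactSpace) (mem_univ _) (mem_univ _))

theorem mem_proximalPairs_of_frequently {X : Type*} [MetricSpace X] [CompactSpace X]
    {f : C(X, X)} {p : X × X}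
    (h : ∀ δ > 0, ∃ᶠ n in atTop, dist (f^[n] p.1) (f^[n] p.2) < δ) : p ∈ proximalPairs f := by
  have hb : IsBoundedUnder (· ≥ ·) atTop fun n : ℕ => dist (f^[n] p.1) (f^[n] p.2) :=
    isBoundedUnder_of ⟨0, fun n => dist_nonneg⟩
  refine le_antisymm (le_of_forall_pos_le_add fun δ hδ => ?_) ?_
  · rw [zero_add]
    exact liminf_le_of_frequently_le ((h δ hδ).mono fun _ => le_of_lt) hb
  · refine le_liminf_of_le ?_ (Eventually.of_forall fun n => dist_nonneg)
    exact IsCoboundedUnder.of_frequently_le (a := Metric.diam (univ : Set X))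
      (Frequently.of_forall fun n => Metric.dist_le_diam_of_mem
        (Metric.isBounded_of_compactSpace) (mem_univ _) (mem_univ _))

theorem mem_separatedPairs_iff {X : Type*} [MetricSpace X] [CompactSpace X]
    {f : C(X, X)} {p : X × X} {ε : ℝ} : p ∈ separatedPairs f ε ↔
      ∃ ε' > ε, ∃ᶠ n in atTop, ε' < dist (f^[n] p.1) (f^[n] p.2) := by
  have hb : IsBoundedUnder (· ≤ ·) atTop fun n : ℕ => dist (f^[n] p.1) (f^[n] p.2) :=
    isBoundedUnder_of ⟨Metric.diam (univ : Set X), fun n => Metric.dist_le_diam_of_mem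
      (Metric.isBounded_of_compactSpace) (mem_univ _) (mem_univ _)⟩
  constructor
  · intro h
    obtain ⟨ε', h1, h2⟩ := exists_between (show ε < _ from h)
    exact ⟨ε', h1, frequently_lt_of_lt_limsup
      (IsCoboundedUnder.of_frequently_ge (a := 0) (Frequently.of_forall fun n => dist_nonneg)) h2⟩
  · rintro ⟨ε', h1, h2⟩
    exact lt_of_lt_of_le h1 (le_limsup_of_frequently_le (h2.mono fun _ => le_of_lt) hb)

/-- Every compact set is approximated by finite subsets, all of whose small perturbations
approximate it too. -/
theorem exists_finset_dist_lt {X : Type*} [MetricSpace X] (A : NonemptyCompacts X) {r : ℝ}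
    (hr : 0 < r) : ∃ F : Finset X, F.Nonempty ∧ (↑F ⊆ (A : Set X)) ∧
      ∀ (A' : NonemptyCompacts X) (a : X → X), (A' : Set X) = a '' F →
        (∀ x ∈ F, dist (a x) x < r) → dist A' A ≤ 2 * r := by
  obtain ⟨t, htA, htf, hcov⟩ := A.isCompact.finite_cover_balls hr
  lift t to Finset X using htf
  have hcov' : ∀ y ∈ A, ∃ x ∈ t, dist y x < r := fun y hy => by
    simpa using hcov hy
  refine ⟨t, ?_, htA, fun A' a hA' ha => ?_⟩
  · obtain ⟨y, hy⟩ := A.nonempty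
    obtain ⟨x, hx, -⟩ := hcov' y hy
    exact ⟨x, hx⟩
  · rw [Metric.NonemptyCompacts.dist_eq]
    refine Metric.hausdorffDist_le_of_mem_dist (by positivity) ?_ ?_
    · rw [hA']
      rintro _ ⟨x, hx, rfl⟩
      exact ⟨x, htA hx, by linarith [ha x hx]⟩
    · intro y hy
      obtain ⟨x, hx, hxy⟩ := hcov' y hy
      refine ⟨a x, hA' ▸ mem_image_of_mem a hx, ?_⟩
      have := dist_triangle y x (a x)
      rw [dist_comm x] at this
      linarith [ha x hx]

/-- The nonempty compact set of the values of `a` on a nonempty finite set. -/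
def finsetImageCompacts {X : Type*} [MetricSpace X] (a : X → X) (F : Finset X) (hF : F.Nonempty) :
    NonemptyCompacts X :=
  ⟨⟨a '' F, (F.finite_toSet.image a).isCompact⟩, (Finset.coe_nonempty.2 hF).image a⟩

/-- A set of pairs in the hyperspace is dense if pairs of finite sets can be perturbed into it. -/
theorem dense_of_exists_perturbation {S : Set (NonemptyCompacts I × NonemptyCompacts I)}
    (h : ∀ (F G : Finset I) (hF : F.Nonempty) (hG : G.Nonempty) (a b : I → I), (∀ x, a x < b x) →
      ∃ y z : I → I, (∀ x ∈ F, y x ∈ Icc (a x) (b x)) ∧ (∀ x ∈ G, z x ∈ Icc (a x) (b x)) ∧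
        (finsetImageCompacts y F hF, finsetImageCompacts z G hG) ∈ S) : Dense S := by
  rw [Metric.dense_iff]
  rintro ⟨A, B⟩ r hr
  obtain ⟨F, hF, -, hFA⟩ := exists_finset_dist_lt A (r := r / 3) (by positivity)
  obtain ⟨G, hG, -, hGB⟩ := exists_finset_dist_lt B (r := r / 3) (by positivity)
  have hball : ∀ x : I, ∃ a b, a < b ∧ Icc a b ⊆ Metric.ball x (r / 3) := fun x =>
    exists_Icc_subset_of_isOpen Metric.isOpen_ball (Metric.nonempty_ball.2 (by positivity))
  choose a b hab hsub using hball
  obtain ⟨y, z, hy, hz, hS⟩ := h F G hF hG a b hab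
  refine ⟨_, ?_, hS⟩
  rw [Metric.mem_ball, Prod.dist_eq, max_lt_iff]
  exact ⟨(hFA (finsetImageCompacts y F hF) y rfl fun x hx => hsub x (hy x hx)).trans_lt (by linarith),
    (hGB (finsetImageCompacts z G hG) z rfl fun x hx => hsub x (hz x hx)).trans_lt (by linarith)⟩

/-- If all intervals are pairwise proximal and spread by more than `ε`, the induced map is
generically `ε`-chaotic. -/
theorem genericallyEpsChaotic_inducedMap (f : C(I, I)) {ε : ℝ} (hε : 0 < ε)
    (H : ∀ a b, a < b → ∃ ε' > ε, SpreadsBeyond f ε' (Icc a b))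
    (hprox : ∀ a b c d, a < b → c < d → ProximalSets f (Icc a b) (Icc c d)) :
    GenericallyEpsChaotic (inducedMap f) ε := by
  obtain ⟨ε', hε', H'⟩ := exists_uniform_spread f.continuous hε H
  have hε0 : 0 < ε' := lt_trans hε hε'
  let d : ℕ → NonemptyCompacts I × NonemptyCompacts I → ℝ := fun t p =>
    dist ((inducedMap f)^[t] p.1) ((inducedMap f)^[t] p.2)
  have hd : ∀ t, Continuous (d t) := fun t =>
    (((inducedMap f).continuous.iterate t).comp continuous_fst).dist
      (((inducedMap f).continuous.iterate t).comp continuous_snd)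
  -- Membership in all `P n` gives liminf zero, and in all `S n` limsup at least `ε'`. The uniform
  -- `ε' > ε` makes the latter strict.
  let P : ℕ → Set (NonemptyCompacts I × NonemptyCompacts I) := fun n =>
    ⋃ t ≥ n, {p | d t p < 1 / (n + 1)}
  let S : ℕ → Set (NonemptyCompacts I × NonemptyCompacts I) := fun n =>
    ⋃ t ≥ n, {p | ε' < d t p}
  have hP : ∀ n, P n ∈ residual _ := by
    refine fun n => residual_of_dense_open
      (isOpen_biUnion fun t _ => isOpen_lt (hd t) continuous_const) ?_
    refine dense_of_exists_perturbation fun F G hF hG a b hab => ?_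
    have hn : (0 : ℝ) < 1 / (n + 1) := by positivity
    classical
    obtain ⟨t, ⟨p, x, hx⟩, ht⟩ := ((eventually_exists_common_point f.continuous hε0 H' hprox hab
      (F ∪ G) (hF.mono Finset.subset_union_left) (δ := 1 / (n + 1) / 3) (by positivity)).and
      (eventually_ge_atTop n)).exists
    have hxF := fun i hi => hx i (Finset.mem_union_left G hi)
    have hxG := fun i hi => hx i (Finset.mem_union_right F hi)
    refine ⟨x, x, fun i hi => (hxF i hi).1, fun i hi => (hxG i hi).1, ?_⟩
    refine mem_biUnion (show t ≥ n from ht) ?_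
    change dist _ _ < _
    rw [Metric.NonemptyCompacts.dist_eq, coe_inducedMap_iterate, coe_inducedMap_iterate]
    have hclose : ∀ i ∈ F, ∀ j ∈ G, dist (f^[t] (x i)) (f^[t] (x j)) ≤ 2 / 3 * (1 / (n + 1)) := by
      intro i hi j hj
      have := dist_triangle_right (f^[t] (x i)) (f^[t] (x j)) p
      linarith [(hxF i hi).2, (hxG j hj).2]
    obtain ⟨i₀, hi₀⟩ := hF
    obtain ⟨j₀, hj₀⟩ := hG
    refine lt_of_le_of_lt (Metric.hausdorffDist_le_of_mem_dist (r := 2 / 3 * (1 / (n + 1)))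
      (by positivity) ?_ ?_) (by linarith)
    · rintro _ ⟨_, ⟨i, hi, rfl⟩, rfl⟩
      exact ⟨_, ⟨_, ⟨j₀, hj₀, rfl⟩, rfl⟩, hclose i hi j₀ hj₀⟩
    · rintro _ ⟨_, ⟨j, hj, rfl⟩, rfl⟩
      exact ⟨_, ⟨_, ⟨i₀, hi₀, rfl⟩, rfl⟩, by rw [dist_comm]; exact hclose i₀ hi₀ j hj⟩
  have hS : ∀ n, S n ∈ residual _ := by
    refine fun n => residual_of_dense_open
      (isOpen_biUnion fun t _ => isOpen_lt continuous_const (hd t)) ?_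
    refine dense_of_exists_perturbation fun F G hF hG a b hab => ?_
    classical
    obtain ⟨i₀, hi₀⟩ := id hF
    obtain ⟨t, ⟨x, hx, y, hy⟩, ht⟩ := ((frequently_exists_separated f.continuous hε0 H' hprox hab
      G (hab i₀)).and_eventually (eventually_ge_atTop n)).exists
    -- A single point of the first set far from the whole second set already makes the Hausdorff
    -- distance large.
    refine ⟨Function.update a i₀ x, y, fun i _ => ?_, fun j hj => (hy j hj).1, ?_⟩
    · rcases eq_or_ne i i₀ with rfl | hne
      · simpa using hx
      · simpa [hne] using (hab i).le
    refine mem_biUnion (show t ≥ n from ht) ?_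
    change _ < dist _ _
    rw [Metric.NonemptyCompacts.dist_eq]
    by_contra! hle
    obtain ⟨j, hj, hlt⟩ : ∃ j ∈ G, ∀ k ∈ G, dist (f^[t] x) (f^[t] (y j)) ≤
        dist (f^[t] x) (f^[t] (y k)) :=
      G.exists_min_image (fun j => dist (f^[t] x) (f^[t] (y j))) hG
    have hlt' := hle.trans_lt (hy j hj).2
    rw [coe_inducedMap_iterate, coe_inducedMap_iterate] at hlt'
    have hxm : f^[t] x ∈ f^[t] '' (finsetImageCompacts (Function.update a i₀ x) F hF : Set I) :=
      ⟨x, ⟨i₀, hi₀, by simp⟩, rfl⟩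
    obtain ⟨_, ⟨_, ⟨k, hk, rfl⟩, rfl⟩, hk'⟩ := Metric.exists_dist_lt_of_hausdorffDist_lt hxm hlt'
      (Metric.hausdorffEDist_ne_top_of_nonempty_of_bounded
        (((Finset.coe_nonempty.2 ⟨i₀, hi₀⟩).image _).image _) (((Finset.coe_nonempty.2 hG).image _).image _)
        Metric.isBounded_of_compactSpace Metric.isBounded_of_compactSpace)
    exact absurd (hlt k hk) (not_le.2 hk')
  refine mem_of_superset (inter_mem (countable_iInter_mem.2 hP) (countable_iInter_mem.2 hS)) ?_
  rintro p ⟨hpP, hpS⟩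
  rw [mem_iInter] at hpP hpS
  refine ⟨mem_proximalPairs_of_frequently fun δ hδ => frequently_atTop.2 fun N => ?_,
    mem_separatedPairs_iff.2 ⟨ε', hε', frequently_atTop.2 fun N => ?_⟩⟩
  · obtain ⟨m, hm⟩ := exists_nat_one_div_lt hδ
    obtain ⟨t, ht, hlt⟩ := mem_iUnion₂.1 (hpP (max m N))
    refine ⟨t, le_trans (le_max_right _ _) ht, lt_of_lt_of_le hlt (le_trans ?_ hm.le)⟩
    apply one_div_le_one_div_of_le (by positivity)
    have : (m : ℝ) ≤ (max m N : ℕ) := by exact_mod_cast le_max_left m N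
    linarith
  · obtain ⟨t, ht, hlt⟩ := mem_iUnion₂.1 (hpS N)
    exact ⟨t, ht, hlt⟩

end Hyperspace

/-! ### From individual spreading to uniform spreading -/

section UniformSpread

open Set Topology unitInterval

/-- If a continuous map moves all points of an order-connected invariant set `C` upwards, the
iterates converge on `C`, uniformly on compact subsets. -/
theorem exists_iterate_tendsto_of_lt {α : Type*} [LinearOrder α] [TopologicalSpace α]
    [OrderTopology α] [CompactSpace α] {g : α → α} (hg : Continuous g) {C Q : Set α}
    (hC : OrdConnected C) (hgC : MapsTo g C C) (hlt : ∀ x ∈ C, x < g x) (hQ : IsCompact Q)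
    (hQC : Q ⊆ C) (hne : Q.Nonempty) :
    ∃ p, ∀ V ∈ 𝓝 p, ∃ j₀, ∀ j ≥ j₀, ∀ x ∈ Q, g^[j] x ∈ V := by
  obtain ⟨p, hp, hpu⟩ := (isClosed_closure (s := C)).isCompact.exists_isGreatest
    ((hne.mono hQC).mono subset_closure)
  have hpu' : ∀ x ∈ C, x ≤ p := fun x hx => hpu (subset_closure hx)
  refine ⟨p, fun V hV => ?_⟩
  have hit : ∀ j, MapsTo g^[j] C C := fun j => hgC.iterate j
  have hmono : ∀ x ∈ C, Monotone fun j => g^[j] x := fun x hx => monotone_nat_of_le_succ fun j => by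
    simpa only [Function.iterate_succ_apply'] using (hlt _ (hit j hx)).le
  have hlow : ∃ l, l < p := by
    obtain ⟨x, hx⟩ := hne
    exact ⟨x, (hlt x (hQC hx)).trans_le (hpu' _ (hgC (hQC hx)))⟩
  obtain ⟨l, hl, hlV⟩ := exists_Ioc_subset_of_mem_nhds hV hlow
  obtain ⟨w, hlw, hw⟩ := mem_closure_iff.1 hp (Ioi l) isOpen_Ioi hl
  have hreach : ∀ x ∈ C, ∃ j, l < g^[j] x := by
    intro x hx
    -- Were the orbit bounded by `l`, the supremum `q` of its closure would lie in `C`, between `x`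
    -- and `w`, and `g q > q` would again be in that closure.
    by_contra! hle
    let O := closure (range fun j => g^[j] x)
    obtain ⟨q, hq, hqu⟩ := (isClosed_closure (s := range fun j => g^[j] x)).isCompact.exists_isGreatest
      ((range_nonempty _).mono subset_closure)
    have hOw : O ⊆ Icc x w := by
      refine closure_minimal ?_ isClosed_Icc
      rintro _ ⟨j, rfl⟩
      exact ⟨hmono x hx (Nat.zero_le j), (hle j).trans (le_of_lt hlw)⟩
    have hgO : MapsTo g O O := by
      refine MapsTo.closure ?_ hg
      rintro _ ⟨j, rfl⟩
      exact ⟨j + 1, Function.iterate_succ_apply' _ _ _⟩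
    exact (hlt q (hC.out hx hw (hOw hq))).not_ge (hqu (hgO hq))
  obtain ⟨s, hs⟩ := hQ.elim_finite_subcover (fun j => {x | l < g^[j] x})
    (fun j => isOpen_lt continuous_const (hg.iterate j))
    (fun x hx => mem_iUnion.2 (hreach x (hQC hx)))
  refine ⟨s.sup id, fun j hj x hx => hlV ⟨?_, hpu' _ (hit j (hQC hx))⟩⟩
  obtain ⟨i, hi, hix⟩ := mem_iUnion₂.1 (hs hx)
  exact lt_of_lt_of_le hix (hmono x (hQC hx) ((Finset.le_sup (f := id) hi).trans hj))

/-- Every spreading interval has an image containing a periodic point. -/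
theorem exists_isPeriodicPt_mem_image {f : I → I} (hf : Continuous f) {ε : ℝ} (hε : 0 < ε)
    {a b : I} (h : SpreadsBeyond f ε (Icc a b)) :
    ∃ t, ∃ p ∈ f^[t] '' Icc a b, ∃ k > 0, Function.IsPeriodicPt f k p := by
  obtain ⟨K, hK, hKε⟩ := exists_finset_Icc hε
  obtain ⟨φ, hφ, hφs⟩ := extraction_of_frequently_atTop h
  have hcov : ∀ n, ∃ p : K, Icc p.1.1 p.1.2 ⊆ f^[φ n] '' Icc a b := fun n => by
    obtain ⟨x, hx, y, hy, hxy⟩ := hφs n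
    obtain ⟨c, d, hcd, hsub, hdist⟩ := exists_Icc_subset_image (hf.iterate (φ n))
      isPreconnected_Icc hx hy (dist_pos.1 (hε.trans hxy))
    obtain ⟨p, hp, hps⟩ := hKε c d hcd (by rw [hdist]; exact hxy)
    exact ⟨⟨p, hp⟩, hps.trans hsub⟩
  choose c hc using hcov
  obtain ⟨t, s, hts, w, hwt, hws⟩ : ∃ t s, t < s ∧ ∃ w, w ∈ f^[t] '' Icc a b ∧
      w ∈ f^[s] '' Icc a b := by
    obtain ⟨m, n, hmn, he⟩ : ∃ m n, m < n ∧ c m = c n := by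
      obtain ⟨m, n, hne, h⟩ := Finite.exists_ne_map_eq_of_infinite c
      rcases lt_or_gt_of_ne hne with h' | h'
      exacts [⟨m, n, h', h⟩, ⟨n, m, h', h.symm⟩]
    have hle := (hK _ (c m).2).le
    exact ⟨φ m, φ n, hφ hmn, _, hc m (left_mem_Icc.2 hle), hc n (he ▸ left_mem_Icc.2 hle)⟩
  set k := s - t with hk
  have hk0 : 0 < k := by omega
  set Q := f^[t] '' Icc a b with hQdef
  have hQpre : IsPreconnected Q := isPreconnected_Icc.image _ (hf.iterate t).continuousOn
  have hQcomp : IsCompact Q := isCompact_Icc.image (hf.iterate t)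
  set g := f^[k] with hgdef
  have hg : Continuous g := hf.iterate k
  have hwg : w ∈ g '' Q := by
    rwa [hgdef, hQdef, ← iterate_image_add, show k + t = s by omega]
  -- `Q` meets `g '' Q`, so this union is connected. Without a fixed point in it, `g` moves all of
  -- `C` in one direction, and `Q` converges to one point, contradicting the spread.
  let C : Set I := ⋃ j : ℕ, g^[j] '' Q
  have hCpre : IsPreconnected C := by
    refine IsPreconnected.iUnion_of_chain (fun j => hQpre.image _ (hg.iterate j).continuousOn)
      fun j => ⟨g^[j] w, mem_image_of_mem _ hwt, ?_⟩
    rw [Nat.succ_eq_succ, Nat.succ_eq_add_one, Function.iterate_add, image_comp]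
    exact mem_image_of_mem _ hwg
  have hgC : MapsTo g C C := by
    rintro x hx
    obtain ⟨j, y, hy, rfl⟩ := mem_iUnion.1 hx
    exact mem_iUnion.2 ⟨j + 1, y, hy, Function.iterate_succ_apply' _ _ _⟩
  have hQC : Q ⊆ C := fun x hx => mem_iUnion.2 ⟨0, x, hx, rfl⟩
  by_contra! hno
  have hfix : ∀ x ∈ C, g x ≠ x := by
    intro x hx he
    obtain ⟨j, y, hy, rfl⟩ := mem_iUnion.1 hx
    refine hno (k * j + t) _ ?_ k hk0 he
    rw [iterate_image_add, Function.iterate_mul]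
    exact mem_image_of_mem _ hy
  have hconv : ∃ p, ∀ V ∈ 𝓝 p, ∃ j₀, ∀ j ≥ j₀, ∀ x ∈ Q, g^[j] x ∈ V := by
    by_cases hup : ∀ x ∈ C, x < g x
    · exact exists_iterate_tendsto_of_lt hg hCpre.ordConnected hgC hup hQcomp hQC ⟨w, hwt⟩
    · have hdown : ∀ x ∈ C, g x < x := by
        push Not at hup
        obtain ⟨y, hy, hgy⟩ := hup
        intro x hx
        by_contra! hgx
        obtain ⟨z, hz, he⟩ := hCpre.intermediate_value₂ hy hx hg.continuousOn continuousOn_id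
          hgy hgx
        exact hfix z hz he
      have : CompactSpace Iᵒᵈ := inferInstanceAs (CompactSpace I)
      exact exists_iterate_tendsto_of_lt (α := Iᵒᵈ) hg hCpre.ordConnected.dual hgC hdown hQcomp
        hQC ⟨w, hwt⟩
  obtain ⟨p, hp⟩ := hconv
  obtain ⟨η, hη, hηε⟩ := exists_dist_iterate_lt hf k hε
  obtain ⟨j₀, hj₀⟩ := hp _ (Metric.ball_mem_nhds p (half_pos hη))
  obtain ⟨T, hT, x, hx, y, hy, hxy⟩ := frequently_atTop.1 h (k * j₀ + t)
  have hdecomp : ∀ x, f^[T] x = f^[(T - t) % k] (g^[(T - t) / k] (f^[t] x)) := fun x => by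
    rw [hgdef, ← Function.iterate_mul, ← Function.iterate_add_apply, ← Function.iterate_add_apply]
    congr 2
    have := Nat.mod_add_div (T - t) k
    omega
  have hj : (T - t) / k ≥ j₀ := by
    rw [ge_iff_le, Nat.le_div_iff_mul_le hk0, mul_comm]; omega
  have h1 := hj₀ _ hj _ (mem_image_of_mem f^[t] hx)
  have h2 := hj₀ _ hj _ (mem_image_of_mem f^[t] hy)
  rw [Metric.mem_ball] at h1 h2
  have := hηε (g^[(T - t) / k] (f^[t] x)) (g^[(T - t) / k] (f^[t] y))
    ((dist_triangle_right _ _ p).trans_lt (by linarith)) ((T - t) % k)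
    (Nat.mod_lt _ hk0).le
  rw [← hdecomp x, ← hdecomp y] at this
  exact absurd hxy (not_lt.2 this.le)

/-- An interval that does not spread by `ε` is eventually confined to a small set consisting of
finitely many intervals. -/
theorem exists_small_orbit {f : I → I} (hf : Continuous f) {ε : ℝ}
    (H : ∀ a b, a < b → ∃ e > 0, SpreadsBeyond f e (Icc a b))
    (hprox : ∀ a b c d, a < b → c < d → ProximalSets f (Icc a b) (Icc c d))
    {a b : I} (hab : a < b) (hns : ¬ SpreadsBeyond f ε (Icc a b)) :
    ∃ t₀ k : ℕ, ∃ C : ℕ → Set I, (∀ i, IsPreconnected (C i)) ∧ (∀ i, (C i).Nontrivial) ∧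
      (⋃ t ≥ t₀, f^[t] '' Icc a b) = ⋃ i ∈ Finset.range k, C i ∧
      ∀ x ∈ ⋃ t ≥ t₀, f^[t] '' Icc a b, ∀ y ∈ ⋃ t ≥ t₀, f^[t] '' Icc a b, dist x y ≤ 4 * ε := by
  obtain ⟨e, he, hsp⟩ := H a b hab
  obtain ⟨N, hN⟩ : ∃ N, ∀ t ≥ N, ∀ x ∈ Icc a b, ∀ y ∈ Icc a b, dist (f^[t] x) (f^[t] y) ≤ ε := by
    simpa [SpreadsBeyond, frequently_atTop] using hns
  obtain ⟨t₁, p₁, hp₁, k, hk, hper₁⟩ := exists_isPeriodicPt_mem_image hf he hsp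
  let t₀ := N + t₁
  let p := f^[N] p₁
  have hp : p ∈ f^[t₀] '' Icc a b := by
    rw [iterate_image_add]; exact mem_image_of_mem _ hp₁
  have hper : Function.IsPeriodicPt f k p := hper₁.apply_iterate N
  have hpt : ∀ t ≥ t₀, f^[t - t₀] p ∈ f^[t] '' Icc a b := fun t ht => by
    have := mem_image_of_mem f^[t - t₀] hp
    rwa [← iterate_image_add, Nat.sub_add_cancel ht] at this
  have hnear : ∀ t ≥ t₀, ∀ x ∈ f^[t] '' Icc a b, dist x (f^[t - t₀] p) ≤ ε := by
    rintro t ht _ ⟨x, hx, rfl⟩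
    obtain ⟨y, hy, hye⟩ := hpt t ht
    rw [← hye]
    exact hN t (by omega) x hx y hy
  have hmod : ∀ m n, m ≡ n [MOD k] → f^[m] p = f^[n] p := fun m n hmn => by
    rw [← hper.iterate_mod_apply m, ← hper.iterate_mod_apply n, hmn]
  -- The interval is proximal to its own `r`-th image. Both follow the periodic orbit within `ε`, so
  -- two points of that orbit `r` steps apart are close; waiting `i ≤ k` further steps adjusts the
  -- phase to `m`.
  have horb' : ∀ m r, dist (f^[m] p) (f^[m + r] p) ≤ 2 * ε := by
    intro m r
    refine le_of_forall_pos_le_add fun δ hδ => ?_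
    obtain ⟨η, hη, hηδ⟩ := exists_dist_iterate_lt hf k hδ
    obtain ⟨x, hx, y, hy, hxy⟩ := hsp.exists_ne he.le r
    obtain ⟨u, v, huv, huv', -⟩ := exists_Icc_subset_image (hf.iterate r) isPreconnected_Icc
      hx hy hxy
    obtain ⟨t, ht, x, hx, y', hy', hxy⟩ := frequently_atTop.1
      ((hprox a b u v hab huv).mono subset_rfl huv' η hη) t₀
    obtain ⟨y, hy, rfl⟩ := hy'
    -- Modulo `k`, the factor `k - 1` acts as `-1`: thus `i` is `m - (t - t₀)`.
    let i := (m + (t - t₀) * (k - 1)) % k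
    have hi : i ≤ k := (Nat.mod_lt _ hk).le
    have hcong : t + i - t₀ ≡ m [MOD k] := by
      have h1 : i ≡ m + (t - t₀) * (k - 1) [MOD k] := Nat.mod_modEq _ _
      have h2 : t + i - t₀ = (t - t₀) + i := by omega
      have h3 : (t - t₀) + (m + (t - t₀) * (k - 1)) = m + k * (t - t₀) := by
        obtain ⟨k', rfl⟩ : ∃ k', k = k' + 1 := ⟨k - 1, by omega⟩
        simp only [Nat.add_sub_cancel]; ring
      rw [h2]
      refine (Nat.ModEq.add_left _ h1).trans ?_
      rw [h3]
      exact (Nat.modEq_iff_dvd' (by omega)).2 (by simp) |>.symm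
    have d1 := hnear (t + i) (by omega) _ (mem_image_of_mem _ hx)
    have d2 := hnear (t + i + r) (by omega) _ (mem_image_of_mem _ hy)
    rw [hmod _ _ hcong] at d1
    rw [show t + i + r - t₀ = t + i - t₀ + r by omega,
      hmod _ _ (Nat.ModEq.add_right r hcong)] at d2
    have d3 := hηδ _ _ hxy i hi
    rw [← Function.iterate_add_apply, ← Function.iterate_add_apply, ← Function.iterate_add_apply,
      add_comm i t] at d3
    have t1 := dist_triangle_left (f^[m] p) (f^[m + r] p) (f^[t + i] x)
    have t2 := dist_triangle (f^[t + i] x) (f^[t + i + r] y) (f^[m + r] p)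
    linarith
  have horb : ∀ m n, dist (f^[m] p) (f^[n] p) ≤ 2 * ε := by
    intro m n
    rcases le_total m n with h | h
    · simpa [Nat.add_sub_cancel' h] using horb' m (n - m)
    · rw [dist_comm]; simpa [Nat.add_sub_cancel' h] using horb' n (m - n)
  -- Grouping times by residue modulo `k` gives connected pieces, since all images in a class
  -- contain `f^[i] p`.
  refine ⟨t₀, k, fun i => ⋃ j : ℕ, f^[t₀ + i + k * j] '' Icc a b, fun i => ?_, fun i => ?_, ?_, ?_⟩
  · refine isPreconnected_iUnion ⟨f^[i] p, mem_iInter.2 fun j => ?_⟩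
      fun j => isPreconnected_Icc.image _ (hf.iterate _).continuousOn
    have := hpt (t₀ + i + k * j) (by omega)
    rwa [hmod _ i] at this
    rw [show t₀ + i + k * j - t₀ = i + k * j by omega]
    exact (Nat.modEq_iff_dvd' (by omega)).2 (by simp) |>.symm
  · obtain ⟨x, hx, y, hy, hxy⟩ := hsp.exists_ne he.le (t₀ + i + k * 0)
    exact ⟨_, mem_iUnion.2 ⟨0, x, hx, rfl⟩, _, mem_iUnion.2 ⟨0, y, hy, rfl⟩, hxy⟩
  · ext x
    simp only [mem_iUnion, Finset.mem_range, exists_prop]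
    constructor
    · rintro ⟨t, ht, hx⟩
      refine ⟨(t - t₀) % k, Nat.mod_lt _ hk, (t - t₀) / k, ?_⟩
      rwa [add_assoc, Nat.mod_add_div, Nat.add_sub_cancel' ht]
    · rintro ⟨i, -, j, hx⟩
      exact ⟨_, by omega, hx⟩
  · intro x hx y hy
    obtain ⟨t, ht, hx⟩ := mem_iUnion₂.1 hx
    obtain ⟨s, hs, hy⟩ := mem_iUnion₂.1 hy
    have d1 := hnear t ht x hx
    have d2 := hnear s hs y hy
    have d3 := horb (t - t₀) (s - t₀)
    have t1 := dist_triangle4_right x y (f^[t - t₀] p) (f^[s - t₀] p)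
    linarith

/-- Intervals that spread, but not uniformly, are trapped near a single point. -/
theorem exists_uniform_spread_of_not_trapped {f : I → I} (hf : Continuous f)
    (H : ∀ a b, a < b → ∃ e > 0, SpreadsBeyond f e (Icc a b))
    (hprox : ∀ a b c d, a < b → c < d → ProximalSets f (Icc a b) (Icc c d))
    (hnt : ∀ x₀ u v, u < v → ¬ ∀ δ > 0, ∀ a b, a < b → Icc a b ⊆ Icc u v → ∃ c d, c < d ∧
      Icc c d ⊆ Icc a b ∧ ∀ᶠ t in atTop, ∀ x ∈ Icc c d, dist (f^[t] x) x₀ ≤ δ) :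
    ∃ ε > 0, ∀ a b, a < b → SpreadsBeyond f ε (Icc a b) := by
  by_contra! hcon
  choose! a b hab hns using hcon
  have hsmall := fun ε (hε : ε > 0) => exists_small_orbit hf H hprox (hab ε hε) (hns ε hε)
  choose! t₀ k C hCpre hCnt hOC hOd using hsmall
  let O : ℝ → Set I := fun ε => ⋃ t ≥ t₀ ε, f^[t] '' Icc (a ε) (b ε)
  have hmemO : ∀ ε t x, t ≥ t₀ ε → x ∈ Icc (a ε) (b ε) → f^[t] x ∈ O ε := fun ε t x ht hx =>
    mem_iUnion₂.2 ⟨t, ht, mem_image_of_mem _ hx⟩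
  let z : ℝ → I := fun ε => f^[t₀ ε] (a ε)
  have hz : ∀ ε > 0, z ε ∈ O ε := fun ε hε =>
    hmemO _ _ _ le_rfl (left_mem_Icc.2 (hab ε hε).le)
  -- Small orbits of diameter at most `4 * ε` and `4 * ε'` come arbitrarily close to each other, so
  -- they all cluster at one point.
  have hzz : ∀ ε > 0, ∀ ε' > 0, dist (z ε) (z ε') ≤ 4 * ε + 4 * ε' := by
    intro ε hε ε' hε'
    refine le_of_forall_pos_le_add fun δ hδ => ?_
    obtain ⟨t, ht, x, hx, y, hy, hxy⟩ := frequently_atTop.1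
      (hprox _ _ _ _ (hab ε hε) (hab ε' hε') δ hδ) (max (t₀ ε) (t₀ ε'))
    have d1 := hOd ε hε _ (hz ε hε) _ (hmemO ε t x (le_trans (le_max_left _ _) ht) hx)
    have d2 := hOd ε' hε' _ (hz ε' hε') _ (hmemO ε' t y (le_trans (le_max_right _ _) ht) hy)
    have := dist_triangle4_right (z ε) (z ε') (f^[t] x) (f^[t] y)
    linarith
  obtain ⟨x₀, φ, hφ, hlim⟩ := CompactSpace.tendsto_subseq fun n : ℕ => z (1 / (n + 1))
  have hzx : ∀ ε > 0, dist (z ε) x₀ ≤ 4 * ε := by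
    intro ε hε
    have l1 : Tendsto (fun n => dist (z ε) (z (1 / ((φ n : ℝ) + 1)))) atTop (𝓝 (dist (z ε) x₀)) :=
      tendsto_const_nhds.dist hlim
    have l2 : Tendsto (fun n => 4 * ε + 4 * (1 / ((φ n : ℝ) + 1))) atTop (𝓝 (4 * ε + 4 * 0)) :=
      ((tendsto_one_div_add_atTop_nhds_zero_nat.comp hφ.tendsto_atTop).const_mul 4).const_add _
    have := le_of_tendsto_of_tendsto' l1 l2 fun n => hzz ε hε _ (by positivity)
    linarith
  have hOx : ∀ ε > 0, ∀ x ∈ O ε, dist x x₀ ≤ 8 * ε := fun ε hε x hx => by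
    have := hOd ε hε x hx _ (hz ε hε)
    linarith [dist_triangle x (z ε) x₀, hzx ε hε]
  have happ : ∀ u v, u < v → ∀ η > 0, ∃ᶠ t in atTop, ∃ x ∈ Icc u v, dist (f^[t] x) x₀ < η := by
    intro u v huv η hη
    have hη' : η / 16 > 0 := by positivity
    refine ((hprox _ _ _ _ huv (hab _ hη') (η / 2) (half_pos hη)).and_eventually
      (eventually_ge_atTop (t₀ (η / 16)))).mono ?_
    rintro t ⟨⟨x, hx, y, hy, hxy⟩, ht⟩
    refine ⟨x, hx, ?_⟩
    linarith [dist_triangle (f^[t] x) (f^[t] y) x₀, hOx _ hη' _ (hmemO _ t y ht hy)]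
  let T : ℝ → Set I := fun δ => {x | ∀ t, dist (f^[t] x) x₀ ≤ δ}
  have hTclosed : ∀ δ, IsClosed (T δ) := fun δ => by
    simp only [T, ofPred_forall]
    exact isClosed_iInter fun t => isClosed_le ((hf.iterate t).dist continuous_const)
      continuous_const
  have hTmono : ∀ δ δ', δ ≤ δ' → T δ ⊆ T δ' := fun δ δ' h x hx t => (hx t).trans h
  have hTinv : ∀ δ s, MapsTo f^[s] (T δ) (T δ) := fun δ s x hx t => by
    rw [← Function.iterate_add_apply]; exact hx _
  have hOT : ∀ δ > 0, O (δ / 8) ⊆ T δ := by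
    intro δ hδ x hx s
    obtain ⟨t, ht, y, hy, rfl⟩ := mem_iUnion₂.1 hx
    have := hOx (δ / 8) (by positivity) _ (hmemO (δ / 8) (s + t) y (by omega) hy)
    rw [← Function.iterate_add_apply]
    linarith
  -- `x₀` is in the closure of finitely many nondegenerate connected pieces, hence of one of them,
  -- which provides a one-sided neighbourhood.
  have hside : ∀ δ > 0, ∃ y, y ≠ x₀ ∧ uIcc x₀ y ⊆ T δ := by
    intro δ hδ
    have hδ' : δ / 8 > 0 := by positivity
    have hcl : x₀ ∈ closure (O (δ / 8)) := by
      refine Metric.mem_closure_iff.2 fun η hη => ?_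
      obtain ⟨t, ht, x, hx, hxη⟩ := frequently_atTop.1 (happ _ _ (hab _ hδ') η hη) (t₀ (δ / 8))
      exact ⟨_, hmemO _ t x ht hx, by rwa [dist_comm]⟩
    simp only [O] at hcl
    rw [hOC _ hδ', Finset.closure_biUnion] at hcl
    obtain ⟨i, hi, hxi⟩ := mem_iUnion₂.1 hcl
    have hsub : closure (C (δ / 8) i) ⊆ T δ := by
      refine closure_minimal (Subset.trans ?_ (hOT δ hδ)) (hTclosed δ)
      simp only [O]
      rw [hOC _ hδ']
      exact subset_biUnion_of_mem (u := fun i => C (δ / 8) i) hi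
    obtain ⟨y, hy, hne⟩ := (hCnt _ hδ' i).exists_ne x₀
    exact ⟨y, hne, ((hCpre _ hδ' i).closure.ordConnected.uIcc_subset hxi
      (subset_closure hy)).trans hsub⟩
  have hxT : ∀ δ > 0, x₀ ∈ T δ := fun δ hδ => by
    obtain ⟨y, -, hy⟩ := hside δ hδ
    exact hy left_mem_uIcc
  have hfix : ∀ t, f^[t] x₀ = x₀ := fun t => by
    refine dist_le_zero.1 (le_of_forall_pos_le_add fun δ hδ => ?_)
    rw [zero_add]
    exact hxT δ hδ t
  -- It suffices to find an interval whose images locally lie in the trapping regions.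
  have hsuff : ¬ ∃ u v, u < v ∧ ∀ δ > 0, ∃ V, IsOpen V ∧ x₀ ∈ V ∧
      ∀ t, ∀ x ∈ Icc u v, f^[t] x ∈ V → f^[t] x ∈ T δ := by
    rintro ⟨u, v, huv, hV⟩
    refine hnt x₀ u v huv fun δ hδ a b hab hsub => ?_
    obtain ⟨V, hVo, hxV, hVT⟩ := hV δ hδ
    obtain ⟨η, hη, hηV⟩ := Metric.isOpen_iff.1 hVo x₀ hxV
    obtain ⟨t, x, hx, hxη⟩ := (happ a b hab η hη).exists
    obtain ⟨c, d, hcd, hcdab, hcdV⟩ := exists_Icc_subset_preimage (hf.iterate t) hab hx hVo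
      (hηV hxη)
    refine ⟨c, d, hcd, hcdab, ?_⟩
    filter_upwards [eventually_ge_atTop t] with s hs y hy
    have := hVT t y (hsub (hcdab hy)) (hcdV y hy) (s - t)
    rwa [← Function.iterate_add_apply, Nat.sub_add_cancel hs] at this
  by_cases hR : ∀ δ > 0, ∃ y, x₀ < y ∧ Icc x₀ y ⊆ T δ
  · by_cases hL : ∀ δ > 0, ∃ y, y < x₀ ∧ Icc y x₀ ⊆ T δ
    · refine hsuff ⟨0, 1, zero_lt_one, fun δ hδ => ?_⟩
      obtain ⟨y, hy, hyT⟩ := hR δ hδ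
      obtain ⟨y', hy', hyT'⟩ := hL δ hδ
      refine ⟨Ioo y' y, isOpen_Ioo, ⟨hy', hy⟩, fun t x _ hx => ?_⟩
      rcases le_total (f^[t] x) x₀ with h | h
      · exact hyT' ⟨hx.1.le, h⟩
      · exact hyT ⟨h, hx.2.le⟩
    -- No left neighbourhood lies in `T δ₀`, so images of `Icc x₀ v` cannot cross to the left of the
    -- fixed point: they would fill such a neighbourhood while staying in `T δ₀`.
    · push Not at hL
      obtain ⟨δ₀, hδ₀, hno⟩ := hL
      obtain ⟨v, hv, hvT⟩ := hR δ₀ hδ₀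
      refine hsuff ⟨x₀, v, hv, fun δ hδ => ?_⟩
      obtain ⟨y, hy, hyT⟩ := hR δ hδ
      refine ⟨Iio y, isOpen_Iio, hy, fun t x hx hxy => hyT ⟨?_, le_of_lt hxy⟩⟩
      by_contra! hlt
      refine hno _ hlt (Subset.trans ?_ ((hTinv δ₀ t).mono_left hvT).image_subset)
      refine (isPreconnected_Icc.image _ (hf.iterate t).continuousOn).ordConnected.out
        (mem_image_of_mem _ hx) ⟨x₀, left_mem_Icc.2 hv.le, hfix t⟩
  · push Not at hR
    obtain ⟨δ₀, hδ₀, hno⟩ := hR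
    have hL : ∀ δ > 0, ∃ y, y < x₀ ∧ Icc y x₀ ⊆ T δ := by
      intro δ hδ
      obtain ⟨y, hne, hy⟩ := hside (min δ δ₀) (lt_min hδ hδ₀)
      rcases lt_or_gt_of_ne hne with h | h
      · rw [uIcc_of_ge h.le] at hy
        exact ⟨y, h, hy.trans (hTmono _ _ (min_le_left _ _))⟩
      · rw [uIcc_of_le h.le] at hy
        exact absurd (hy.trans (hTmono _ _ (min_le_right _ _))) (hno y h)
    obtain ⟨u, hu, huT⟩ := hL δ₀ hδ₀
    refine hsuff ⟨u, x₀, hu, fun δ hδ => ?_⟩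
    obtain ⟨y, hy, hyT⟩ := hL δ hδ
    refine ⟨Ioi y, isOpen_Ioi, hy, fun t x hx hxy => hyT ⟨le_of_lt hxy, ?_⟩⟩
    by_contra! hlt
    refine hno _ hlt (Subset.trans ?_ ((hTinv δ₀ t).mono_left huT).image_subset)
    refine (isPreconnected_Icc.image _ (hf.iterate t).continuousOn).ordConnected.out
      ⟨x₀, right_mem_Icc.2 hu.le, hfix t⟩ (mem_image_of_mem _ hx)

end UniformSpread

/-! ### Transfer between generic chaos and intervals -/

section GenericChaos

open Set Topology unitInterval

/-- A system `g` whose points are represented, compatibly with the dynamics and the metric, by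
compact subsets of `I`, richly enough to see open sets; both `f` itself and the map induced by `f`
are of this kind. -/
structure IsSetRepresentation (f : C(I, I)) {X : Type*} [MetricSpace X] (g : C(X, X))
    (S : X → NonemptyCompacts I) : Prop where
  isometry : Isometry S
  semiconj : Function.Semiconj S g (inducedMap f)
  exists_subset : ∀ U : Set I, IsOpen U → U.Nonempty → ∃ x, (S x : Set I) ⊆ U
  mem_closure : ∀ G W : Set I, IsOpen G → IsOpen W → G ⊆ closure W → ∀ x, (S x : Set I) ⊆ G →
    x ∈ closure {x' | (S x' : Set I) ⊆ W}

theorem isSetRepresentation_singleton (f : C(I, I)) :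
    IsSetRepresentation f f fun x => ({x} : NonemptyCompacts I) where
  isometry := NonemptyCompacts.isometry_singleton
  semiconj x := by
    apply SetLike.coe_injective
    change ({f x} : Set I) = f '' {x}
    rw [image_singleton]
  exists_subset U _ hne := hne.imp fun x hx => singleton_subset_iff.2 hx
  mem_closure G W _ _ h x hx := by
    have e : {x' : I | (({x'} : NonemptyCompacts I) : Set I) ⊆ W} = W := by
      ext y; exact singleton_subset_iff
    rw [e]
    exact h (singleton_subset_iff.1 hx)

theorem isSetRepresentation_id (f : C(I, I)) : IsSetRepresentation f (inducedMap f) id where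
  isometry := isometry_id
  semiconj _ := rfl
  exists_subset U _ hne := hne.imp' (fun x => {x}) fun x hx => singleton_subset_iff.2 hx
  mem_closure G W hG hW h A hA := by
    refine Metric.mem_closure_iff.2 fun r hr => ?_
    obtain ⟨F, hF, hFA, hr'⟩ := exists_finset_dist_lt A (r := r / 3) (by positivity)
    have : ∀ x ∈ F, ∃ y ∈ W, dist y x < r / 3 := fun x hx => by
      obtain ⟨y, hy, hxy⟩ := Metric.mem_closure_iff.1 (h (hA (hFA hx))) (r / 3) (by positivity)
      exact ⟨y, hy, by rwa [dist_comm]⟩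
    choose! a ha using this
    refine ⟨finsetImageCompacts a F hF, ?_, ?_⟩
    · rintro _ ⟨x, hx, rfl⟩
      exact (ha x hx).1
    · rw [dist_comm]
      exact (hr' (finsetImageCompacts a F hF) a rfl fun x hx => (ha x hx).2).trans_lt (by linarith)

namespace IsSetRepresentation

variable {f : C(I, I)} {X : Type*} [MetricSpace X] {g : C(X, X)} {S : X → NonemptyCompacts I}

theorem dist_iterate (h : IsSetRepresentation f g S) (n : ℕ) (x y : X) :
    dist (g^[n] x) (g^[n] y) = Metric.hausdorffDist (f^[n] '' S x) (f^[n] '' S y) := by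
  rw [← h.isometry.dist_eq, (h.semiconj.iterate_right n).eq, (h.semiconj.iterate_right n).eq,
    Metric.NonemptyCompacts.dist_eq, coe_inducedMap_iterate, coe_inducedMap_iterate]

theorem isOpen_subset (h : IsSetRepresentation f g S) {U : Set I} (hU : IsOpen U) :
    IsOpen {x | (S x : Set I) ⊆ U} :=
  (NonemptyCompacts.isOpen_subsets_of_isOpen hU).preimage h.isometry.continuous

variable [CompactSpace X]

theorem exists_mem_residual (h : IsSetRepresentation f g S) {R : Set (X × X)}
    (hR : R ∈ residual (X × X)) {U V : Set I} (hU : IsOpen U) (hV : IsOpen V) (hUn : U.Nonempty)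
    (hVn : V.Nonempty) : ∃ p ∈ R, (S p.1 : Set I) ⊆ U ∧ (S p.2 : Set I) ⊆ V := by
  obtain ⟨x, hx⟩ := h.exists_subset U hU hUn
  obtain ⟨y, hy⟩ := h.exists_subset V hV hVn
  obtain ⟨p, hp, hpR⟩ := (dense_of_mem_residual hR).inter_open_nonempty _
    ((h.isOpen_subset hU).prod (h.isOpen_subset hV)) ⟨(x, y), hx, hy⟩
  exact ⟨p, hpR, hp.1, hp.2⟩

theorem proximalSets (h : IsSetRepresentation f g S) (hR : proximalPairs g ∈ residual (X × X))
    (a b c d : I) (hab : a < b) (hcd : c < d) : ProximalSets f (Icc a b) (Icc c d) := by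
  obtain ⟨p, hp, h1, h2⟩ := h.exists_mem_residual hR isOpen_Ioo isOpen_Ioo (nonempty_Ioo.2 hab)
    (nonempty_Ioo.2 hcd)
  intro δ hδ
  refine (frequently_dist_lt_of_mem_proximalPairs hp hδ).mono fun t ht => ?_
  rw [h.dist_iterate] at ht
  obtain ⟨x, hx⟩ := (S p.1).nonempty
  obtain ⟨_, ⟨y, hy, rfl⟩, hxy⟩ := Metric.exists_dist_lt_of_hausdorffDist_lt
    (mem_image_of_mem f^[t] hx) ht (Metric.hausdorffEDist_ne_top_of_nonempty_of_bounded
      ((S p.1).nonempty.image _) ((S p.2).nonempty.image _)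
      Metric.isBounded_of_compactSpace Metric.isBounded_of_compactSpace)
  exact ⟨x, Ioo_subset_Icc_self (h1 hx), y, Ioo_subset_Icc_self (h2 hy), hxy⟩

/-- Both members of a generic separated pair can be taken inside the same interval. Were all its
points close at time `t`, the Hausdorff distance would be small too. -/
theorem exists_spreadsBeyond (h : IsSetRepresentation f g S) {ε : ℝ} (hε : 0 ≤ ε)
    (hR : separatedPairs g ε ∈ residual (X × X)) (a b : I) (hab : a < b) :
    ∃ ε' > ε, SpreadsBeyond f ε' (Icc a b) := by
  obtain ⟨p, hp, h1, h2⟩ := h.exists_mem_residual hR isOpen_Ioo isOpen_Ioo (nonempty_Ioo.2 hab)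
    (nonempty_Ioo.2 hab)
  obtain ⟨ε', hε', hfr⟩ := mem_separatedPairs_iff.1 hp
  refine ⟨ε', hε', hfr.mono fun t ht => ?_⟩
  rw [h.dist_iterate] at ht
  by_contra! hle
  obtain ⟨x₀, hx₀⟩ := (S p.1).nonempty
  obtain ⟨y₀, hy₀⟩ := (S p.2).nonempty
  refine ht.not_ge (Metric.hausdorffDist_le_of_mem_dist (hε.trans hε'.le) ?_ ?_)
  · rintro _ ⟨x, hx, rfl⟩
    exact ⟨_, mem_image_of_mem _ hy₀, hle x (Ioo_subset_Icc_self (h1 hx)) _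
      (Ioo_subset_Icc_self (h2 hy₀))⟩
  · rintro _ ⟨y, hy, rfl⟩
    exact ⟨_, mem_image_of_mem _ hx₀, hle y (Ioo_subset_Icc_self (h2 hy)) _
      (Ioo_subset_Icc_self (h1 hx₀))⟩

/-- Generic chaos excludes an interval in which generic points converge to one point. -/
theorem not_trapped (h : IsSetRepresentation f g S) (hg : GenericallyChaotic g) (x₀ u v : I)
    (huv : u < v) : ¬ ∀ δ > 0, ∀ a b, a < b → Icc a b ⊆ Icc u v → ∃ c d, c < d ∧
      Icc c d ⊆ Icc a b ∧ ∀ᶠ t in atTop, ∀ x ∈ Icc c d, dist (f^[t] x) x₀ ≤ δ := by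
  intro htrap
  let W : ℝ → Set I := fun δ => ⋃ (p : I × I)
    (_ : ∀ᶠ t in atTop, ∀ x ∈ Icc p.1 p.2, dist (f^[t] x) x₀ ≤ δ), Ioo p.1 p.2
  have hWo : ∀ δ, IsOpen (W δ) := fun δ => isOpen_biUnion fun _ _ => isOpen_Ioo
  have hWcl : ∀ δ > 0, Ioo u v ⊆ closure (W δ) := by
    intro δ hδ x hx
    refine mem_closure_iff.2 fun V hV hxV => ?_
    obtain ⟨a, b, hab, hsub⟩ := exists_Icc_subset_of_isOpen (hV.inter isOpen_Ioo) ⟨x, hxV, hx⟩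
    obtain ⟨c, d, hcd, hcdab, hev⟩ := htrap δ hδ a b hab
      (hsub.trans (inter_subset_right.trans Ioo_subset_Icc_self))
    obtain ⟨m, hm⟩ := nonempty_Ioo.2 hcd
    exact ⟨m, (hsub (hcdab (Ioo_subset_Icc_self hm))).1, mem_iUnion₂.2 ⟨(c, d), hev, hm⟩⟩
  -- Each interval in `W δ` has its own waiting time; compactness of `A` yields a common one.
  have hWev : ∀ δ, ∀ A : NonemptyCompacts I, (A : Set I) ⊆ W δ →
      ∀ᶠ t in atTop, ∀ y ∈ (A : Set I), dist (f^[t] y) x₀ ≤ δ := by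
    intro δ A hA
    refine A.isCompact.induction_on (p := fun s => ∀ᶠ t in atTop, ∀ y ∈ s, dist (f^[t] y) x₀ ≤ δ)
      (by simp) (fun s t hst ht => ht.mono fun n hn y hy => hn y (hst hy))
      (fun s t hs ht => (hs.and ht).mono fun n hn y hy => hy.elim (hn.1 y) (hn.2 y)) ?_
    intro x hx
    obtain ⟨p, hp, hxp⟩ := mem_iUnion₂.1 (hA hx)
    exact ⟨Ioo p.1 p.2, mem_nhdsWithin_of_mem_nhds (isOpen_Ioo.mem_nhds hxp),
      hp.mono fun n hn y hy => hn y (Ioo_subset_Icc_self hy)⟩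
  let P : Set X := {x | (S x : Set I) ⊆ Ioo u v}
  -- The complement of `closure P` is added only to make `D n` dense in all of `X`.
  let D : ℕ → Set X := fun n => {x | (S x : Set I) ⊆ W (1 / (n + 1))} ∪ (closure P)ᶜ
  have hDo : ∀ n, IsOpen (D n) := fun n =>
    (h.isOpen_subset (hWo _)).union isClosed_closure.isOpen_compl
  have hDd : ∀ n, Dense (D n) := by
    intro n x
    by_cases hx : x ∈ closure P
    · refine closure_mono subset_union_left ?_
      refine closure_minimal (fun y hy => ?_) isClosed_closure hx
      exact h.mem_closure _ _ isOpen_Ioo (hWo _) (hWcl _ (by positivity)) y hy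
    · exact subset_closure (.inr hx)
  have hR : liYorkePairs g ∩ ⋂ n, (Prod.fst ⁻¹' D n ∩ Prod.snd ⁻¹' D n) ∈ residual (X × X) := by
    refine inter_mem hg (countable_iInter_mem.2 fun n => inter_mem ?_ ?_)
    · exact residual_of_dense_open ((hDo n).preimage continuous_fst)
        ((hDd n).preimage isOpenMap_fst)
    · exact residual_of_dense_open ((hDo n).preimage continuous_snd)
        ((hDd n).preimage isOpenMap_snd)
  obtain ⟨⟨x, y⟩, ⟨hLY, hD⟩, hx, hy⟩ := h.exists_mem_residual hR isOpen_Ioo isOpen_Ioo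
    (nonempty_Ioo.2 huv) (nonempty_Ioo.2 huv)
  obtain ⟨ε, hε, hfr⟩ := mem_separatedPairs_iff.1 hLY.2
  obtain ⟨n, hn⟩ := exists_nat_one_div_lt (half_pos hε)
  have hDn := mem_iInter.1 hD n
  have hxW : (S x : Set I) ⊆ W (1 / (n + 1)) :=
    hDn.1.resolve_right fun hc => hc (subset_closure hx)
  have hyW : (S y : Set I) ⊆ W (1 / (n + 1)) :=
    hDn.2.resolve_right fun hc => hc (subset_closure hy)
  obtain ⟨t, ht, hxt, hyt⟩ := (hfr.and_eventually ((hWev _ _ hxW).and (hWev _ _ hyW))).exists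
  have hclose : ∀ z ∈ S x, ∀ w ∈ S y, dist (f^[t] z) (f^[t] w) ≤ ε := fun z hz w hw => by
    have := dist_triangle_right (f^[t] z) (f^[t] w) x₀
    linarith [hxt z hz, hyt w hw]
  rw [h.dist_iterate] at ht
  obtain ⟨z₀, hz₀⟩ := (S x).nonempty
  obtain ⟨w₀, hw₀⟩ := (S y).nonempty
  refine ht.not_ge (Metric.hausdorffDist_le_of_mem_dist hε.le ?_ ?_)
  · rintro _ ⟨z, hz, rfl⟩
    exact ⟨_, mem_image_of_mem _ hw₀, hclose z hz _ hw₀⟩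
  · rintro _ ⟨w, hw, rfl⟩
    exact ⟨_, mem_image_of_mem _ hz₀, by rw [dist_comm]; exact hclose _ hz₀ w hw⟩

/-- If `f` or its induced map is generically chaotic, then the induced map is generically
`ε`-chaotic for some `ε`. -/
theorem exists_genericallyEpsChaotic (h : IsSetRepresentation f g S) (hg : GenericallyChaotic g) :
    ∃ ε : ℝ, 0 < ε ∧ GenericallyEpsChaotic (inducedMap f) ε := by
  have hprox := h.proximalSets (mem_of_superset hg inter_subset_left)
  obtain ⟨ε, hε, hsp⟩ := exists_uniform_spread_of_not_trapped f.continuous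
    (h.exists_spreadsBeyond le_rfl (mem_of_superset hg inter_subset_right)) hprox
    (h.not_trapped hg)
  -- Halving provides the strict margin between the chaos constant and the spread.
  exact ⟨ε / 2, half_pos hε, genericallyEpsChaotic_inducedMap f (half_pos hε)
    (fun a b hab => ⟨ε, half_lt_self hε, hsp a b hab⟩) hprox⟩

end IsSetRepresentation

theorem GenericallyEpsChaotic.genericallyChaotic {X : Type*} [MetricSpace X] [CompactSpace X]
    {g : C(X, X)} {ε : ℝ} (hε : 0 ≤ ε) (h : GenericallyEpsChaotic g ε) : GenericallyChaotic g :=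
  mem_of_superset h (inter_subset_inter_right _ fun _ hp => lt_of_le_of_lt hε hp)

end GenericChaos

theorem corollary4p5 (f : C(unitInterval, unitInterval)) :
    (∀ ε : ℝ, 0 < ε → GenericallyEpsChaotic f ε → GenericallyEpsChaotic (inducedMap f) ε) ∧
    (GenericallyChaotic f → GenericallyChaotic (inducedMap f)) ∧
    (GenericallyChaotic (inducedMap f) →
      ∃ ε : ℝ, 0 < ε ∧ GenericallyEpsChaotic (inducedMap f) ε) := by
  have hf := isSetRepresentation_singleton f
  refine ⟨fun ε hε h => genericallyEpsChaotic_inducedMap f hε ?_ ?_, fun h => ?_,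
    (isSetRepresentation_id f).exists_genericallyEpsChaotic⟩
  · exact hf.exists_spreadsBeyond hε.le (mem_of_superset h Set.inter_subset_right)
  · exact hf.proximalSets (mem_of_superset h Set.inter_subset_left)
  · obtain ⟨ε, hε, h'⟩ := hf.exists_genericallyEpsChaotic h
    exact h'.genericallyChaotic hε.le
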